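/- Let $C:[0,1]^2\to[0,1]$ be a copula and let $\mu_C$ be the Borel probability measure on $[0,1]^2$ with $\mu_C([0,x]\times[0,y])=C(x,y)$ for all $x,y\in[0,1]$. Suppose that, in the Lebesgue decomposition of $\mu_C$ with respect to two-dimensional Lebesgue measure, the density $c(x,y)$ of the absolutely continuous part is strictly positive on a subset of $[0,1]^2$ of Lebesgue measure $1$. Let $(U_i)_{i\in\mathbb Z}$ be the stationary Markov chain generated by $C$, that is, a strictly stationary real-valued Markov chain on a probability space such that $U_0$ is uniformly distributed on $[0,1]$ and $\Pr(U_0\le x,\,U_1\le y)=C(x,y)$ for all $x,y\in[0,1]$. Let $\pi$ be the law of $U_0$ and let $P^n(x,A)=\Pr(U_n\in A\mid U_0=x)$ (regular conditional distributions), $P=P^1$. Then: 1. the chain is irreducible: there is a Borel set $B$ with $\pi(B)=1$ such that for all $x\in B$ and every Borel set $A$ with $\pi(A)>0$ there is an integer $n=n(x,A)\ge1$ with $P^n(x,A)>0$; 2. the chain is aperiodic: there are no $d\ge2$ and pairwise disjoint Borel sets $D_0,\dots,D_{d-1}$ with $\pi\big(\bigcup_i D_i\big)=1$ such that, for every $i$,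 $P(x,D_{i+1 \bmod d})=1$ for $\pi$-almost every $x\in D_i$; 3. the chain is absolutely regular: $\beta_n\to0$ as $n\to\infty$, where $\beta_n=\beta\big(\sigma(U_k,\,k\le0),\,\sigma(U_k,\,k\ge n)\big)$ and, for $\sigma$-algebras $\mathcal A,\mathcal B$ of events, $$\beta(\mathcal A,\mathcal B)=\frac12\sup\sum_{i}\sum_{j}\big|\Pr(A_i\cap B_j)-\Pr(A_i)\Pr(B_j)\big|,$$ the supremum being over all finite partitions $\{A_i\}$, $\{B_j\}$ of the probability space with $A_i\in\mathcal A$ and $B_j\in\mathcal B$. -/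

import Mathlib

open MeasureTheory ProbabilityTheory Filter Topology Set
open scoped ENNReal

/-- A (bivariate) copula `C : [0,1]² → ℝ`: grounded, with uniform margins and 2-increasing.
Only the values of `C` on the unit square matter. -/
structure IsCopula (C : ℝ → ℝ → ℝ) : Prop where
  zero_left : ∀ y ∈ Icc (0 : ℝ) 1, C 0 y = 0
  zero_right : ∀ x ∈ Icc (0 : ℝ) 1, C x 0 = 0
  one_left : ∀ y ∈ Icc (0 : ℝ) 1, C 1 y = y
  one_right : ∀ x ∈ Icc (0 : ℝ) 1, C x 1 = x
  two_increasing : ∀ x₁ ∈ Icc (0 : ℝ) 1, ∀ x₂ ∈ Icc (0 : ℝ) 1,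
    ∀ y₁ ∈ Icc (0 : ℝ) 1, ∀ y₂ ∈ Icc (0 : ℝ) 1, x₁ ≤ x₂ → y₁ ≤ y₂ →
      0 ≤ C x₂ y₂ - C x₁ y₂ - C x₂ y₁ + C x₁ y₁

/-- `μ` is the measure on the unit square (regarded as a measure on the plane) induced by `C`:
it is carried by `[0,1]²` and `μ ([0,x] × [0,y]) = C (x, y)`. Every copula induces exactly one
such measure, and it is a probability measure since `C (1, 1) = 1`. -/
structure IsCopulaMeasure (C : ℝ → ℝ → ℝ) (μ : Measure (ℝ × ℝ)) : Prop where
  compl_unitSquare : μ (Icc (0 : ℝ) 1 ×ˢ Icc (0 : ℝ) 1)ᶜ = 0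
  rectangle : ∀ x ∈ Icc (0 : ℝ) 1, ∀ y ∈ Icc (0 : ℝ) 1,
    μ (Icc 0 x ×ˢ Icc 0 y) = ENNReal.ofReal (C x y)

/-- The absolutely continuous part of the copula `C` has a strictly positive density on a subset
of the unit square of Lebesgue measure `1`. The density is the Radon-Nikodym derivative of the
absolutely continuous part, in the Lebesgue decomposition with respect to two-dimensional
Lebesgue measure, of the measure induced by `C`. The singular part is arbitrary. -/
def HasPositiveACDensity (C : ℝ → ℝ → ℝ) : Prop :=
  ∃ μ : Measure (ℝ × ℝ), IsCopulaMeasure C μ ∧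
    ∀ᵐ z ∂((volume : Measure (ℝ × ℝ)).restrict (Icc (0 : ℝ) 1 ×ˢ Icc (0 : ℝ) 1)),
      0 < μ.rnDeriv volume z

section Chains

variable {Ω : Type*} [MeasurableSpace Ω]

/-- The σ-algebra `σ(U_k, k ≤ n)`. -/
abbrev sigmaPast (U : ℤ → Ω → ℝ) (n : ℤ) : MeasurableSpace Ω :=
  ⨆ k : ℤ, ⨆ _ : k ≤ n, MeasurableSpace.comap (U k) inferInstance

/-- The σ-algebra `σ(U_k, k ≥ n)`. -/
abbrev sigmaFuture (U : ℤ → Ω → ℝ) (n : ℤ) : MeasurableSpace Ω :=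
  ⨆ k : ℤ, ⨆ _ : n ≤ k, MeasurableSpace.comap (U k) inferInstance

/-- `(U_i)_{i ∈ ℤ}` is a strictly stationary real-valued Markov chain on `(Ω, P)`. -/
structure IsStationaryMarkovChain (P : Measure Ω) (U : ℤ → Ω → ℝ) : Prop where
  measurable : ∀ i, Measurable (U i)
  stationary : ∀ k : ℤ,
    P.map (fun ω (i : ℤ) => U (i + k) ω) = P.map (fun ω (i : ℤ) => U i ω)
  /-- `Pr(U_{n+1} ∈ S | U_k, k ≤ n) = Pr(U_{n+1} ∈ S | U_n)` almost surely. -/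
  markov : ∀ (n : ℤ) (S : Set ℝ), MeasurableSet S →
    P⟦U (n + 1) ⁻¹' S | sigmaPast U n⟧
      =ᵐ[P] P⟦U (n + 1) ⁻¹' S | MeasurableSpace.comap (U n) inferInstance⟧

/-- `(U_i)_{i ∈ ℤ}` is the stationary Markov chain generated by the copula `C`: its marginal
distribution is uniform on `[0,1]` and `C` is the joint distribution function of
`(U_0, U_1)`. -/
structure IsGeneratedByCopula (P : Measure Ω) (U : ℤ → Ω → ℝ) (C : ℝ → ℝ → ℝ) : Prop
    extends IsStationaryMarkovChain P U where
  uniform : P.map (U 0) = (volume : Measure ℝ).restrict (Icc 0 1)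
  joint : ∀ x ∈ Icc (0 : ℝ) 1, ∀ y ∈ Icc (0 : ℝ) 1,
    P {ω | U 0 ω ≤ x ∧ U 1 ω ≤ y} = ENNReal.ofReal (C x y)

/-- The `n`-step transition probabilities `Pⁿ(x, A) = Pr(U_n ∈ A | U_0 = x)`: the regular
conditional distribution of `U_n` given `U_0`. The notions below do not depend on the
choice of the version. -/
noncomputable def transitionProb (P : Measure Ω) [IsFiniteMeasure P] (U : ℤ → Ω → ℝ) (n : ℕ) :
    Kernel ℝ ℝ :=
  condDistrib (U n) (U 0) P

/-- Irreducibility of a stationary chain with marginal law `π`: there is a set `B` with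
`π(B) = 1` such that for all `x ∈ B` and every Borel set `A` with `π(A) > 0` there is a positive
integer `n = n(x, A)` with `Pⁿ(x, A) > 0`. -/
def IsIrreducibleChain (P : Measure Ω) [IsFiniteMeasure P] (U : ℤ → Ω → ℝ) : Prop :=
  ∃ B : Set ℝ, MeasurableSet B ∧ P.map (U 0) B = 1 ∧
    ∀ x ∈ B, ∀ A : Set ℝ, MeasurableSet A → 0 < P.map (U 0) A →
      ∃ n : ℕ, 0 < n ∧ 0 < transitionProb P U n x A

/-- `D_0, …, D_{d-1}` (indexed cyclically) is a `d`-cycle of the chain: disjoint Borel sets whose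
union has full measure under the marginal law, such that the chain moves from `D_i` to `D_{i+1}`
with probability one from almost every point of `D_i`. -/
structure IsCycle (P : Measure Ω) [IsFiniteMeasure P] (U : ℤ → Ω → ℝ) (d : ℕ)
    (D : ZMod d → Set ℝ) : Prop where
  measurableSet : ∀ i, MeasurableSet (D i)
  disjoint : Pairwise (fun i j => Disjoint (D i) (D j))
  full : P.map (U 0) (⋃ i, D i) = 1
  step : ∀ i, ∀ᵐ x ∂(P.map (U 0)), x ∈ D i → transitionProb P U 1 x (D (i + 1)) = 1

/-- Aperiodicity: there is no `d`-cycle with `d ≥ 2`. -/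
def IsAperiodicChain (P : Measure Ω) [IsFiniteMeasure P] (U : ℤ → Ω → ℝ) : Prop :=
  ∀ (d : ℕ) (D : ZMod d → Set ℝ), 2 ≤ d → ¬ IsCycle P U d D

/-- `A_0, …, A_{n-1}` is a finite partition of `Ω` into sets of the σ-algebra `𝒜`. -/
structure IsFinitePartition (𝒜 : MeasurableSpace Ω) {n : ℕ} (A : Fin n → Set Ω) : Prop where
  measurableSet : ∀ i, MeasurableSet[𝒜] (A i)
  disjoint : Pairwise (fun i j => Disjoint (A i) (A j))
  union : ⋃ i, A i = univ

/-- The coefficient of absolute regularity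
`β(𝒜, ℬ) = ½ sup ∑ᵢ ∑ⱼ |Pr(Aᵢ ∩ Bⱼ) - Pr(Aᵢ) Pr(Bⱼ)|`, the supremum being taken over all finite
partitions `{Aᵢ}`, `{Bⱼ}` of `Ω` with `Aᵢ ∈ 𝒜` and `Bⱼ ∈ ℬ`. -/
noncomputable def betaCoeff (P : Measure Ω) (𝒜 ℬ : MeasurableSpace Ω) : ℝ≥0∞ :=
  2⁻¹ * ⨆ (n : ℕ) (m : ℕ) (A : Fin n → Set Ω) (B : Fin m → Set Ω)
    (_ : IsFinitePartition 𝒜 A) (_ : IsFinitePartition ℬ B),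
      ∑ i, ∑ j, ENNReal.ofReal |P.real (A i ∩ B j) - P.real (A i) * P.real (B j)|

/-- `β_n = β(σ(U_k, k ≤ 0), σ(U_k, k ≥ n))`. -/
noncomputable def betaMixing (P : Measure Ω) (U : ℤ → Ω → ℝ) (n : ℕ) : ℝ≥0∞ :=
  betaCoeff P (sigmaPast U 0) (sigmaFuture U n)

/-- Absolute regularity: `β_n → 0` as `n → ∞`. -/
def IsAbsolutelyRegular (P : Measure Ω) (U : ℤ → Ω → ℝ) : Prop :=
  Tendsto (betaMixing P U) atTop (𝓝 0)

end Chains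

/-! Let `π` be the uniform law and `κ` the one-step transition kernel. Positivity of the density
gives `π ⊗ π ≪ μ_C`, and disintegrating over the first coordinate gives `π ≪ κ x` for `π`-almost
every `x`. The singular part of `μ_C` plays no role. Irreducibility (with `n = 1`) and aperiodicity
follow at once.

Absolute regularity rests on a minorization argument. Outside a set of small measure in `y`, the
density of `κ` exceeds some `η` for more than 3/4 of the `x`. Truncation yields `k ≤ a` with `k x y`
a subdensity of `κ x`, `a` independent of `x`, and column means of `k` at least `3a/4`. If `|g - c|
≤ V`, then, with `w = g - c`, the function `κg` is within `κV + ∫ (a - 2k)V dπ` of the constant `c +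
∫ a w dπ`. Iterating from `V₀ = 1` gives bounds `Vₙ` that do not depend on the starting function. By
invariance and `a - 2·(3/4)a = -a/2`, the mean of `Vₙ` drops by at least `½ ∫ a Vₙ dπ` at each step.
Hence these integrals are summable with total at most 2, the `Vₙ` are bounded by 3, and `∫ Vₙ dπ`
becomes small, since `a` is constant off a small set (`IsMinorant.sum_integral_bound_mul_le`,
`exists_uniform_bound_iterate`).

The Markov property turns `P(A ∩ B)`, for past `A` and future `B`, into an integral of an `n`-th
iterate. Uniformity over test functions then bounds `βₙ` (`IsStationaryMarkovChain.sum_abs_sub_le`).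
-/

/-! ### Measures determined by copulas and domination by positive densities -/

/-- A copula induces at most one measure. -/
theorem IsCopulaMeasure.unique {C : ℝ → ℝ → ℝ} {μ ν : Measure (ℝ × ℝ)}
    (hμ : IsCopulaMeasure C μ) (hν : IsCopulaMeasure C ν) : μ = ν := by
  have key : ∀ ρ : Measure (ℝ × ℝ), IsCopulaMeasure C ρ → ∀ a b : ℝ,
      ρ (Iic a ×ˢ Iic b) = if 0 ≤ a ∧ 0 ≤ b then ENNReal.ofReal (C (min a 1) (min b 1)) else 0 := by
    intro ρ hρ a b
    split_ifs with hab
    · rw [← hρ.rectangle (min a 1) ⟨le_min hab.1 zero_le_one, min_le_right _ _⟩ (min b 1)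
        ⟨le_min hab.2 zero_le_one, min_le_right _ _⟩]
      refine measure_congr ?_
      have h0 : ∀ᵐ z ∂ρ, z ∈ Icc (0 : ℝ) 1 ×ˢ Icc (0 : ℝ) 1 := by
        rw [ae_iff]; exact hρ.compl_unitSquare
      filter_upwards [h0] with z hz
      simp only [mem_prod, mem_Icc] at hz
      apply propext
      change (z ∈ Iic a ×ˢ Iic b) ↔ (z ∈ Icc 0 (min a 1) ×ˢ Icc 0 (min b 1))
      simp only [mem_prod, mem_Iic, mem_Icc, le_min_iff]
      tauto
    · refine measure_mono_null ?_ hρ.compl_unitSquare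
      rintro z ⟨h1, h2⟩ ⟨h3, h4⟩
      exact hab ⟨h3.1.trans h1, h4.1.trans h2⟩
  have fin : ∀ ρ : Measure (ℝ × ℝ), IsCopulaMeasure C ρ → IsFiniteMeasure ρ := by
    intro ρ hρ
    refine ⟨?_⟩
    rw [← measure_add_measure_compl (measurableSet_Icc.prod measurableSet_Icc :
      MeasurableSet (Icc (0 : ℝ) 1 ×ˢ Icc (0 : ℝ) 1)), hρ.compl_unitSquare,
      hρ.rectangle 1 (by simp) 1 (by simp)]
    simp
  have := fin μ hμ
  have := fin ν hν
  -- Agreement on quadrants is extended one coordinate at a time: first to `s × Iic b` for Borel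
  -- `s`, then to all rectangles.
  have h1 : ∀ b : ℝ, (μ.restrict (univ ×ˢ Iic b)).map Prod.fst
      = (ν.restrict (univ ×ˢ Iic b)).map Prod.fst := by
    intro b
    refine Measure.ext_of_Iic _ _ fun a => ?_
    have hset : (Prod.fst ⁻¹' Iic a : Set (ℝ × ℝ)) ∩ univ ×ˢ Iic b = Iic a ×ˢ Iic b := by
      ext z; simp [Prod.le_def]
    rw [Measure.map_apply measurable_fst measurableSet_Iic,
      Measure.map_apply measurable_fst measurableSet_Iic,
      Measure.restrict_apply (measurable_fst measurableSet_Iic),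
      Measure.restrict_apply (measurable_fst measurableSet_Iic), hset, key μ hμ, key ν hν]
  refine Measure.ext_prod fun {s} {t} hs ht => ?_
  have h2 : (μ.restrict (s ×ˢ univ)).map Prod.snd = (ν.restrict (s ×ˢ univ)).map Prod.snd := by
    refine Measure.ext_of_Iic _ _ fun b => ?_
    have hset : (Prod.snd ⁻¹' Iic b : Set (ℝ × ℝ)) ∩ s ×ˢ univ
        = Prod.fst ⁻¹' s ∩ univ ×ˢ Iic b := by
      ext z; simp [and_comm]
    have := congrArg (fun m => m s) (h1 b)
    simp only [Measure.map_apply measurable_fst hs,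
      Measure.restrict_apply (measurable_fst hs)] at this
    rw [Measure.map_apply measurable_snd measurableSet_Iic,
      Measure.map_apply measurable_snd measurableSet_Iic,
      Measure.restrict_apply (measurable_snd measurableSet_Iic),
      Measure.restrict_apply (measurable_snd measurableSet_Iic), hset, this]
  have hset : (Prod.snd ⁻¹' t : Set (ℝ × ℝ)) ∩ s ×ˢ univ = s ×ˢ t := by
    ext z; simp [and_comm]
  have := congrArg (fun m => m t) h2
  simpa only [Measure.map_apply measurable_snd ht,
    Measure.restrict_apply (measurable_snd ht), hset] using this

/-- A measure dominates the restriction of `ν` to any set on which its density is positive. -/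
theorem absolutelyContinuous_restrict_of_rnDeriv_pos {α : Type*} {mα : MeasurableSpace α}
    {μ ν : Measure α} {Q : Set α}
    (h : ∀ᵐ z ∂(ν.restrict Q), 0 < μ.rnDeriv ν z) : ν.restrict Q ≪ μ := by
  refine Measure.AbsolutelyContinuous.mk fun s hs hμs => ?_
  -- The density integrates over a `μ`-null set to at most its `μ`-mass, so it vanishes `ν`-a.e.
  -- there. Where it is positive, the set must be `ν`-null.
  have h0 : ∫⁻ z in s, μ.rnDeriv ν z ∂ν = 0 :=
    le_antisymm ((Measure.setLIntegral_rnDeriv_le s).trans hμs.le) zero_le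
  rw [lintegral_eq_zero_iff (Measure.measurable_rnDeriv _ _), EventuallyEq,
    ae_restrict_iff' hs] at h0
  have h1 := ae_restrict_of_ae (s := Q) h0
  rw [← compl_compl s, ← mem_ae_iff]
  filter_upwards [h, h1] with z hz hz' hzs
  exact hz.ne' (hz' hzs)

/-! ### Domination of the stationary law; irreducibility and aperiodicity -/

section Chain

variable {Ω : Type*} [MeasurableSpace Ω] {P : Measure Ω} {U : ℤ → Ω → ℝ}

theorem IsStationaryMarkovChain.map_eq (hU : IsStationaryMarkovChain P U) (k : ℤ) :
    P.map (U k) = P.map (U 0) := by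
  have hm : Measurable fun ω (i : ℤ) => U (i + k) ω :=
    measurable_pi_lambda _ fun i => hU.measurable _
  have hm' : Measurable fun ω (i : ℤ) => U i ω := measurable_pi_lambda _ fun i => hU.measurable _
  have := congrArg (Measure.map fun z : ℤ → ℝ => z 0) (hU.stationary k)
  rw [Measure.map_map (measurable_pi_apply 0) hm, Measure.map_map (measurable_pi_apply 0) hm']
    at this
  simpa [Function.comp_def] using this

theorem IsStationaryMarkovChain.map_pair_eq (hU : IsStationaryMarkovChain P U) (k : ℤ) :
    P.map (fun ω => (U k ω, U (k + 1) ω)) = P.map (fun ω => (U 0 ω, U 1 ω)) := by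
  have hm : Measurable fun ω (i : ℤ) => U (i + k) ω :=
    measurable_pi_lambda _ fun i => hU.measurable _
  have hm' : Measurable fun ω (i : ℤ) => U i ω := measurable_pi_lambda _ fun i => hU.measurable _
  have hg : Measurable fun z : ℤ → ℝ => (z 0, z 1) := by fun_prop
  have := congrArg (Measure.map fun z : ℤ → ℝ => (z 0, z 1)) (hU.stationary k)
  rw [Measure.map_map hg hm, Measure.map_map hg hm'] at this
  simpa [Function.comp_def, add_comm] using this

theorem IsGeneratedByCopula.isCopulaMeasure {C : ℝ → ℝ → ℝ} (hU : IsGeneratedByCopula P U C) :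
    IsCopulaMeasure C (P.map fun ω => (U 0 ω, U 1 ω)) := by
  have hm : Measurable fun ω => (U 0 ω, U 1 ω) := (hU.measurable 0).prodMk (hU.measurable 1)
  have hI : ∀ k, ∀ᵐ ω ∂P, U k ω ∈ Icc (0 : ℝ) 1 := by
    intro k
    refine ae_of_ae_map (hU.measurable k).aemeasurable (p := fun x => x ∈ Icc (0 : ℝ) 1) ?_
    rw [hU.map_eq k, hU.uniform]
    exact ae_restrict_mem measurableSet_Icc
  constructor
  · rw [Measure.map_apply hm (measurableSet_Icc.prod measurableSet_Icc).compl, ← nonpos_iff_eq_zero]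
    have : ∀ᵐ ω ∂P, ω ∉ (fun ω => (U 0 ω, U 1 ω)) ⁻¹' (Icc (0 : ℝ) 1 ×ˢ Icc (0 : ℝ) 1)ᶜ := by
      filter_upwards [hI 0, hI 1] with ω h0 h1 h
      exact h ⟨h0, h1⟩
    exact (measure_eq_zero_iff_ae_notMem.2 this).le
  · intro x hx y hy
    rw [Measure.map_apply hm (measurableSet_Icc.prod measurableSet_Icc), ← hU.joint x hx y hy]
    refine measure_congr ?_
    filter_upwards [hI 0, hI 1] with ω h0 h1
    apply propext
    change ((U 0 ω, U 1 ω) ∈ Icc 0 x ×ˢ Icc 0 y) ↔ (U 0 ω ≤ x ∧ U 1 ω ≤ y)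
    simp only [mem_prod, mem_Icc]
    have := h0.1
    have := h1.1
    tauto

/-- Uniqueness identifies the measure in the hypothesis with the law of `(U 0, U 1)`, which
disintegrates as `π ⊗ κ`. Lebesgue measure on the square is `π ⊗ π`, so absolute continuity passes
to almost every fibre. -/
theorem IsGeneratedByCopula.ae_absolutelyContinuous [IsProbabilityMeasure P] {C : ℝ → ℝ → ℝ}
    (hU : IsGeneratedByCopula P U C) (hpos : HasPositiveACDensity C) :
    ∀ᵐ x ∂(P.map (U 0)), P.map (U 0) ≪ condDistrib (U 1) (U 0) P x := by
  obtain ⟨μ, hμ, hd⟩ := hpos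
  rw [hμ.unique hU.isCopulaMeasure] at hd
  have := absolutelyContinuous_restrict_of_rnDeriv_pos hd
  rw [Measure.volume_eq_prod, ← Measure.prod_restrict, ← hU.uniform, ← Measure.compProd_const,
    ← compProd_map_condDistrib (hU.measurable 1).aemeasurable] at this
  simpa using this.kernel_of_compProd

theorem isIrreducibleChain_of_ae_absolutelyContinuous [IsProbabilityMeasure P]
    (hm : Measurable (U 0))
    (h : ∀ᵐ x ∂(P.map (U 0)), P.map (U 0) ≪ condDistrib (U 1) (U 0) P x) :
    IsIrreducibleChain P U := by
  have := Measure.isProbabilityMeasure_map (μ := P) hm.aemeasurable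
  -- The set of good points need not be measurable, so the complement of a measurable hull of the
  -- bad points is used.
  refine ⟨(toMeasurable (P.map (U 0))
    {x | ¬ P.map (U 0) ≪ condDistrib (U 1) (U 0) P x})ᶜ, (measurableSet_toMeasurable _ _).compl,
    ?_, ?_⟩
  · rw [prob_compl_eq_one_iff (measurableSet_toMeasurable _ _), measure_toMeasurable]
    exact h
  · intro x hx A _ hA
    have hac : P.map (U 0) ≪ condDistrib (U 1) (U 0) P x := by
      by_contra hn
      exact hx (subset_toMeasurable _ _ hn)
    refine ⟨1, one_pos, pos_iff_ne_zero.2 fun h0 => hA.ne' (hac ?_)⟩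
    simpa [transitionProb] using h0

/-- From a typical point of `D i` the chain moves almost surely into `D (i + 1)`, which is disjoint
from `D i` because `d ≥ 2`. So `D i` is null for a transition law dominating `π`, hence `π`-null. A
cycle would then have total mass zero. -/
theorem isAperiodicChain_of_ae_absolutelyContinuous [IsProbabilityMeasure P]
    (hm : Measurable (U 0))
    (h : ∀ᵐ x ∂(P.map (U 0)), P.map (U 0) ≪ condDistrib (U 1) (U 0) P x) :
    IsAperiodicChain P U := by
  have := Measure.isProbabilityMeasure_map (μ := P) hm.aemeasurable
  intro d D hd hD
  have : NeZero d := ⟨by omega⟩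
  have : Fact (1 < d) := ⟨by omega⟩
  have hz : ∀ i, P.map (U 0) (D i) = 0 := by
    intro i
    by_contra hi
    obtain ⟨x, hx, hac, hstep⟩ :=
      ((frequently_ae_mem_iff.2 hi).and_eventually (h.and (hD.step i))).exists
    have h1 := hstep hx
    have h2 : condDistrib (U 1) (U 0) P x (D i) = 0 := by
      refine measure_mono_null (t := (D (i + 1))ᶜ) ?_ ?_
      · exact (hD.disjoint (by simp)).subset_compl_right
      · exact (prob_compl_eq_zero_iff (hD.measurableSet _)).2 (by simpa [transitionProb] using h1)
    exact hi (hac h2)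
  have h0 := hD.full
  rw [measure_iUnion_null hz] at h0
  exact zero_ne_one h0

end Chain

/-! ### Contraction of deviations from constants under a minorant -/

section Contraction

variable {X : Type*} [MeasurableSpace X]

theorem integrable_of_measurable_of_abs_le {m : Measure X} [IsFiniteMeasure m] {f : X → ℝ}
    (hf : Measurable f) (C : ℝ) (h : ∀ x, |f x| ≤ C) : Integrable f m :=
  Integrable.of_bound hf.aestronglyMeasurable C (ae_of_all _ h)

theorem integral_comp_measure {m : Measure X} [IsFiniteMeasure m] {κ : Kernel X X}
    [IsMarkovKernel κ] {f : X → ℝ} (hf : Measurable f) (C : ℝ) (h : ∀ x, |f x| ≤ C) :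
    ∫ x, f x ∂(κ ∘ₘ m) = ∫ x, ∫ y, f y ∂(κ x) ∂m := by
  rw [← Measure.snd_compProd, Measure.snd, integral_map measurable_snd.aemeasurable
    hf.aestronglyMeasurable, Measure.integral_compProd]
  exact integrable_of_measurable_of_abs_le (hf.comp measurable_snd) C fun z => h z.2

theorem measurable_integral_kernel {κ : Kernel X X} {f : X → ℝ} (hf : Measurable f) :
    Measurable fun x => ∫ y, f y ∂(κ x) :=
  hf.stronglyMeasurable.integral_kernel.measurable

theorem abs_integral_le_of_abs_le {m : Measure X} [IsProbabilityMeasure m] {f : X → ℝ} {C : ℝ}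
    (h : ∀ x, |f x| ≤ C) : |∫ x, f x ∂m| ≤ C := by
  simpa using norm_integral_le_of_norm_le_const (μ := m) (f := f) (C := C) (ae_of_all _ h)

/-- The kernel `κ` dominates the kernel with density `k` with respect to `π`, where `k (x, y)` is
at most `a y` and its average over `x` is at least `3 / 4 * a y`. -/
structure IsMinorant (κ : Kernel X X) (π : Measure X) (k : X → X → ℝ) (a : X → ℝ) (M : ℝ) :
    Prop where
  measurable_density : Measurable (Function.uncurry k)
  measurable_bound : Measurable a
  nonneg : ∀ x y, 0 ≤ k x y
  le_bound : ∀ x y, k x y ≤ a y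
  bound_le : ∀ y, a y ≤ M
  withDensity_le : ∀ x, π.withDensity (fun y => ENNReal.ofReal (k x y)) ≤ κ x
  column : ∀ y, 3 / 4 * a y ≤ ∫ x, k x y ∂π

/-- A bound on the deviation from constants of the iterates of `κ` on functions bounded by one. -/
noncomputable def deviationBound (κ : Kernel X X) (π : Measure X) (k : X → X → ℝ) (a : X → ℝ) :
    ℕ → X → ℝ
  | 0 => fun _ => 1
  | n + 1 => fun x => ∫ y, deviationBound κ π k a n y ∂(κ x)
      + ∫ y, (a y - 2 * k x y) * deviationBound κ π k a n y ∂π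

set_option linter.unusedSectionVars false

variable {κ : Kernel X X} [IsMarkovKernel κ] {π : Measure X} [IsProbabilityMeasure π]
  {k : X → X → ℝ} {a : X → ℝ} {M : ℝ}

theorem IsMinorant.bound_nonneg (h : IsMinorant κ π k a M) (y : X) : 0 ≤ a y :=
  (h.nonneg y y).trans (h.le_bound y y)

theorem IsMinorant.measurable_right (h : IsMinorant κ π k a M) (x : X) : Measurable (k x) :=
  h.measurable_density.comp measurable_prodMk_left

theorem abs_mul_le_mul_of_abs_le {p q A B : ℝ} (hp : |p| ≤ A) (hq : |q| ≤ B) : |p * q| ≤ A * B := by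
  rw [abs_mul]
  exact mul_le_mul hp hq (abs_nonneg _) ((abs_nonneg _).trans hp)

theorem IsMinorant.abs_density_le (h : IsMinorant κ π k a M) (x y : X) : |k x y| ≤ M := by
  rw [abs_of_nonneg (h.nonneg x y)]
  exact (h.le_bound x y).trans (h.bound_le y)

theorem IsMinorant.abs_bound_le (h : IsMinorant κ π k a M) (y : X) : |a y| ≤ M := by
  rw [abs_of_nonneg (h.bound_nonneg y)]
  exact h.bound_le y

theorem IsMinorant.abs_weight_le (h : IsMinorant κ π k a M) (x y : X) :
    |a y - 2 * k x y| ≤ M := by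
  have := h.nonneg x y
  have := h.le_bound x y
  have := h.bound_le y
  rw [abs_le]
  constructor <;> linarith

theorem IsMinorant.integrable_density_mul (h : IsMinorant κ π k a M) {g : X → ℝ}
    (hg : Measurable g) {C : ℝ} (hC : ∀ y, |g y| ≤ C) (x : X) :
    Integrable (fun y => k x y * g y) π :=
  integrable_of_measurable_of_abs_le ((h.measurable_right x).mul hg) (M * C) fun y =>
    abs_mul_le_mul_of_abs_le (h.abs_density_le x y) (hC y)

theorem IsMinorant.integrable_bound_mul (h : IsMinorant κ π k a M) {g : X → ℝ}
    (hg : Measurable g) {C : ℝ} (hC : ∀ y, |g y| ≤ C) :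
    Integrable (fun y => a y * g y) π :=
  integrable_of_measurable_of_abs_le (h.measurable_bound.mul hg) (M * C) fun y =>
    abs_mul_le_mul_of_abs_le (h.abs_bound_le y) (hC y)

theorem IsMinorant.integral_weight_mul (h : IsMinorant κ π k a M) {g : X → ℝ}
    (hg : Measurable g) {C : ℝ} (hC : ∀ y, |g y| ≤ C) (x : X) :
    ∫ y, (a y - 2 * k x y) * g y ∂π = ∫ y, a y * g y ∂π - 2 * ∫ y, k x y * g y ∂π := by
  rw [← integral_const_mul, ← integral_sub (h.integrable_bound_mul hg hC)
    ((h.integrable_density_mul hg hC x).const_mul 2)]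
  congr with y
  ring

theorem IsMinorant.integral_mul_le (h : IsMinorant κ π k a M) {g : X → ℝ}
    (hg : Measurable g) (hg0 : ∀ y, 0 ≤ g y) {C : ℝ} (hC : ∀ y, |g y| ≤ C) (x : X) :
    ∫ y, k x y * g y ∂π ≤ ∫ y, g y ∂(κ x) := by
  have h1 : ∫ y, k x y * g y ∂π
      = ∫ y, g y ∂(π.withDensity (fun y => ENNReal.ofReal (k x y))) := by
    rw [integral_withDensity_eq_integral_toReal_smul (h.measurable_right x).ennreal_ofReal
      (ae_of_all _ fun _ => by simp)]
    congr with y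
    rw [ENNReal.toReal_ofReal (h.nonneg x y), smul_eq_mul]
  rw [h1]
  exact integral_mono_measure (h.withDensity_le x) (ae_of_all _ hg0)
    (integrable_of_measurable_of_abs_le hg C hC)

theorem IsMinorant.integral_density_mul_le (h : IsMinorant κ π k a M) {g : X → ℝ}
    (hg : Measurable g) (hg0 : ∀ y, 0 ≤ g y) {C : ℝ} (hC : ∀ y, |g y| ≤ C) (x : X) :
    ∫ y, k x y * g y ∂π ≤ ∫ y, a y * g y ∂π :=
  integral_mono (h.integrable_density_mul hg hC x) (h.integrable_bound_mul hg hC) fun y =>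
    mul_le_mul_of_nonneg_right (h.le_bound x y) (hg0 y)

/-- Both signs come from splitting the recursion as `(κV - ∫ kV) + (∫ aV - ∫ kV)`, whose summands
are nonnegative. Dropping `-2 ∫ kV` gives the upper bound, since `κ` averages and so preserves a
constant bound. -/
theorem IsMinorant.deviationBound_properties (h : IsMinorant κ π k a M) (n : ℕ) :
    Measurable (deviationBound κ π k a n) ∧ (∀ x, 0 ≤ deviationBound κ π k a n x) ∧
      ∀ x, deviationBound κ π k a n x
        ≤ 1 + ∑ j ∈ Finset.range n, ∫ y, a y * deviationBound κ π k a j y ∂π := by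
  induction n with
  | zero => simp [deviationBound]
  | succ n ih =>
    obtain ⟨hm, h0, hle⟩ := ih
    set V := deviationBound κ π k a n with hV
    set C := 1 + ∑ j ∈ Finset.range n, ∫ y, a y * deviationBound κ π k a j y ∂π with hCdef
    have hC : ∀ y, |V y| ≤ C := fun y => by rw [abs_of_nonneg (h0 y)]; exact hle y
    have heq : ∀ x, deviationBound κ π k a (n + 1) x
        = ∫ y, V y ∂(κ x) + (∫ y, a y * V y ∂π - 2 * ∫ y, k x y * V y ∂π) := fun x => by
      rw [← h.integral_weight_mul hm hC x]; rfl
    refine ⟨?_, fun x => ?_, fun x => ?_⟩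
    · refine (measurable_integral_kernel hm).add ?_
      refine (StronglyMeasurable.integral_prod_right (f := fun x y => (a y - 2 * k x y) * V y)
        (Measurable.stronglyMeasurable ?_)).measurable
      exact ((h.measurable_bound.comp measurable_snd).sub
        (h.measurable_density.const_mul 2)).mul (hm.comp measurable_snd)
    · rw [heq]
      have := h.integral_mul_le hm h0 hC x
      have := h.integral_density_mul_le hm h0 hC x
      linarith
    · rw [heq, Finset.sum_range_succ, ← add_assoc, ← hCdef, ← hV]
      have h1 : ∫ y, V y ∂(κ x) ≤ C := (le_abs_self _).trans (abs_integral_le_of_abs_le hC)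
      have h2 : 0 ≤ ∫ y, k x y * V y ∂π :=
        integral_nonneg fun y => mul_nonneg (h.nonneg x y) (h0 y)
      linarith

theorem IsMinorant.measurable_deviationBound (h : IsMinorant κ π k a M) (n : ℕ) :
    Measurable (deviationBound κ π k a n) := (h.deviationBound_properties n).1

theorem IsMinorant.deviationBound_nonneg (h : IsMinorant κ π k a M) (n : ℕ) (x : X) :
    0 ≤ deviationBound κ π k a n x := (h.deviationBound_properties n).2.1 x

theorem IsMinorant.exists_abs_deviationBound_le (h : IsMinorant κ π k a M) (n : ℕ) :
    ∃ C, ∀ x, |deviationBound κ π k a n x| ≤ C :=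
  ⟨_, fun x => by
    rw [abs_of_nonneg (h.deviationBound_nonneg n x)]; exact (h.deviationBound_properties n).2.2 x⟩

/-- Integration over `x` preserves the mean of the `κ` term by invariance and replaces `k` by its
column mean in the other term. -/
theorem IsMinorant.integral_deviationBound_succ_le (h : IsMinorant κ π k a M)
    (hinv : κ ∘ₘ π = π) (n : ℕ) :
    ∫ x, deviationBound κ π k a (n + 1) x ∂π ≤ ∫ x, deviationBound κ π k a n x ∂π
      - 1 / 2 * ∫ y, a y * deviationBound κ π k a n y ∂π := by
  obtain ⟨C, hC⟩ := h.exists_abs_deviationBound_le n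
  have hm := h.measurable_deviationBound n
  have h0 := h.deviationBound_nonneg n
  have hdef : ∀ x, deviationBound κ π k a (n + 1) x
      = ∫ y, deviationBound κ π k a n y ∂(κ x)
      + ∫ y, (a y - 2 * k x y) * deviationBound κ π k a n y ∂π := fun x => rfl
  simp only [hdef]
  set V := deviationBound κ π k a n
  have hint : Integrable (Function.uncurry fun x y => (a y - 2 * k x y) * V y) (π.prod π) := by
    refine integrable_of_measurable_of_abs_le ?_ (M * C) fun z =>
      abs_mul_le_mul_of_abs_le (h.abs_weight_le z.1 z.2) (hC z.2)
    exact ((h.measurable_bound.comp measurable_snd).sub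
        (h.measurable_density.const_mul 2)).mul (hm.comp measurable_snd)
  rw [integral_add (integrable_of_measurable_of_abs_le (measurable_integral_kernel hm) C
    fun x => abs_integral_le_of_abs_le hC)
      (show Integrable (fun x => ∫ y, (a y - 2 * k x y) * V y ∂π) π from hint.integral_prod_left),
    ← integral_comp_measure hm C hC, hinv, integral_integral_swap hint, sub_eq_add_neg,
    ← neg_mul, ← integral_const_mul]
  refine add_le_add le_rfl (integral_mono (f := fun y => ∫ x, (a y - 2 * k x y) * V y ∂π)
    hint.integral_prod_right ((h.integrable_bound_mul hm hC).const_mul _) fun y => ?_)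
  have hk : Integrable (fun x => k x y) π :=
    integrable_of_measurable_of_abs_le (h.measurable_density.comp measurable_prodMk_right) M
      fun x => h.abs_density_le x y
  dsimp only
  rw [integral_mul_const, integral_sub (integrable_const _) (hk.const_mul 2), integral_const_mul]
  simp only [integral_const, probReal_univ, one_smul]
  -- `a - 2·(3/4)a = -a/2`; any column fraction above 1/2 would give a strict gain.
  have := mul_le_mul_of_nonneg_right (h.column y) (h0 y)
  nlinarith

theorem IsMinorant.integral_deviationBound_add_sum_le (h : IsMinorant κ π k a M)
    (hinv : κ ∘ₘ π = π) (n : ℕ) :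
    ∫ x, deviationBound κ π k a n x ∂π
      + 1 / 2 * ∑ j ∈ Finset.range n, ∫ y, a y * deviationBound κ π k a j y ∂π ≤ 1 := by
  induction n with
  | zero => simp [deviationBound]
  | succ n ih =>
    rw [Finset.sum_range_succ]
    have := h.integral_deviationBound_succ_le hinv n
    linarith

/-- The drops in the mean telescope from `∫ V₀ dπ = 1` and cannot exceed it, so half their sum is at
most 1. -/
theorem IsMinorant.sum_integral_bound_mul_le (h : IsMinorant κ π k a M)
    (hinv : κ ∘ₘ π = π) (n : ℕ) :
    ∑ j ∈ Finset.range n, ∫ y, a y * deviationBound κ π k a j y ∂π ≤ 2 := by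
  have := h.integral_deviationBound_add_sum_le hinv n
  have : 0 ≤ ∫ x, deviationBound κ π k a n x ∂π := integral_nonneg (h.deviationBound_nonneg n)
  linarith

theorem IsMinorant.deviationBound_le_three (h : IsMinorant κ π k a M)
    (hinv : κ ∘ₘ π = π) (n : ℕ) (x : X) : deviationBound κ π k a n x ≤ 3 := by
  have := (h.deviationBound_properties n).2.2 x
  have := h.sum_integral_bound_mul_le hinv n
  linarith

theorem IsMinorant.tendsto_integral_bound_mul (h : IsMinorant κ π k a M) (hinv : κ ∘ₘ π = π) :
    Tendsto (fun n => ∫ y, a y * deviationBound κ π k a n y ∂π) atTop (𝓝 0) :=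
  (summable_of_sum_range_le (c := 2)
    (fun n => integral_nonneg fun y => mul_nonneg (h.bound_nonneg y) (h.deviationBound_nonneg n y))
    (h.sum_integral_bound_mul_le hinv)).tendsto_atTop_zero

theorem measurable_and_abs_iterate_le {f : X → ℝ} (hf : Measurable f) (hf1 : ∀ x, |f x| ≤ 1)
    (n : ℕ) :
    Measurable ((fun (g : X → ℝ) (x : X) => ∫ y, g y ∂(κ x))^[n] f) ∧
      ∀ x, |(fun (g : X → ℝ) (x : X) => ∫ y, g y ∂(κ x))^[n] f x| ≤ 1 := by
  induction n with
  | zero => exact ⟨hf, hf1⟩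
  | succ n ih =>
    simp only [Function.iterate_succ', Function.comp_apply]
    exact ⟨measurable_integral_kernel ih.1, fun x => abs_integral_le_of_abs_le ih.2⟩

/-- The common part `k` of `κ x` and `a` cancels: `κw - ∫ aw = (κw - ∫ kw) - (∫ aw - ∫ kw)`. Each
difference is a positive functional of `w`, so `|w| ≤ V` bounds the total by `(κV - ∫ kV) + (∫ aV -
∫ kV)`, which is the recursion. -/
theorem IsMinorant.exists_abs_iterate_sub_le (h : IsMinorant κ π k a M) {f : X → ℝ}
    (hf : Measurable f) (hf1 : ∀ x, |f x| ≤ 1) (n : ℕ) :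
    ∃ c : ℝ, ∀ x, |(fun (g : X → ℝ) (x : X) => ∫ y, g y ∂(κ x))^[n] f x - c|
      ≤ deviationBound κ π k a n x := by
  induction n with
  | zero => exact ⟨0, by simpa [deviationBound] using hf1⟩
  | succ n ih =>
    obtain ⟨c, hc⟩ := ih
    obtain ⟨hgm, hg1⟩ := measurable_and_abs_iterate_le (κ := κ) hf hf1 n
    simp only [Function.iterate_succ', Function.comp_apply]
    set g := (fun (g : X → ℝ) (x : X) => ∫ y, g y ∂(κ x))^[n] f
    obtain ⟨C, hC⟩ := h.exists_abs_deviationBound_le n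
    have hm := h.measurable_deviationBound n
    have hdef : ∀ x, deviationBound κ π k a (n + 1) x
        = ∫ y, deviationBound κ π k a n y ∂(κ x)
        + ∫ y, (a y - 2 * k x y) * deviationBound κ π k a n y ∂π := fun x => rfl
    have hV0 := h.deviationBound_nonneg n
    simp only [hdef]
    set V := deviationBound κ π k a n
    set w : X → ℝ := fun y => g y - c
    have hwm : Measurable w := hgm.sub_const c
    have hwV : ∀ y, |w y| ≤ V y := hc
    have hwC : ∀ y, |w y| ≤ C := fun y => (hwV y).trans ((le_abs_self _).trans (hC y))
    refine ⟨c + ∫ y, a y * w y ∂π, fun x => ?_⟩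
    have hi : ∀ {u : X → ℝ}, Measurable u → (∀ y, |u y| ≤ C) → Integrable u (κ x) :=
      fun hu hb => integrable_of_measurable_of_abs_le hu C hb
    have h1 : ∫ y, w y ∂(κ x) = ∫ y, g y ∂(κ x) - c := by
      rw [integral_sub (integrable_of_measurable_of_abs_le hgm 1 hg1) (integrable_const _)]
      simp
    have hbd : ∀ y, |V y - w y| ≤ 2 * C ∧ |V y + w y| ≤ 2 * C := fun y => by
      have h1 := abs_le.1 (hC y)
      have h2 := abs_le.1 (hwC y)
      constructor <;> rw [abs_le] <;> constructor <;> linarith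
    -- Positivity of the two functionals is applied to `V - w` and `V + w`. The upper bound combines
    -- `hA` with `hB'`, the lower one `hB` with `hA'`.
    have hA := h.integral_mul_le (hm.sub hwm) (fun y => sub_nonneg.2 ((le_abs_self _).trans (hwV y)))
      (fun y => (hbd y).1) x
    have hB := h.integral_mul_le (hm.add hwm)
      (fun y => by have := (abs_le.1 (hwV y)).1; simp only [Pi.add_apply]; linarith)
      (fun y => (hbd y).2) x
    have hA' := h.integral_density_mul_le (hm.sub hwm)
      (fun y => sub_nonneg.2 ((le_abs_self _).trans (hwV y))) (fun y => (hbd y).1) x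
    have hB' := h.integral_density_mul_le (hm.add hwm)
      (fun y => by have := (abs_le.1 (hwV y)).1; simp only [Pi.add_apply]; linarith)
      (fun y => (hbd y).2) x
    simp only [Pi.sub_apply, Pi.add_apply, mul_sub, mul_add] at hA hB hA' hB'
    rw [integral_sub (hi hm hC) (hi hwm hwC), integral_sub (h.integrable_density_mul hm hC x)
      (h.integrable_density_mul hwm hwC x)] at hA
    rw [integral_add (hi hm hC) (hi hwm hwC), integral_add (h.integrable_density_mul hm hC x)
      (h.integrable_density_mul hwm hwC x)] at hB
    rw [integral_sub (h.integrable_bound_mul hm hC) (h.integrable_bound_mul hwm hwC),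
      integral_sub (h.integrable_density_mul hm hC x) (h.integrable_density_mul hwm hwC x)] at hA'
    rw [integral_add (h.integrable_bound_mul hm hC) (h.integrable_bound_mul hwm hwC),
      integral_add (h.integrable_density_mul hm hC x) (h.integrable_density_mul hwm hwC x)] at hB'
    rw [h.integral_weight_mul hm hC x, abs_le]
    constructor <;> linarith

/-- Iterates of `κ` on functions bounded by one are close to their mean. -/
theorem IsMinorant.abs_iterate_sub_integral_le (h : IsMinorant κ π k a M)
    (hinv : κ ∘ₘ π = π) {f : X → ℝ} (hf : Measurable f) (hf1 : ∀ x, |f x| ≤ 1) (n : ℕ) (x : X) :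
    |(fun (g : X → ℝ) (x : X) => ∫ y, g y ∂(κ x))^[n] f x - ∫ y, f y ∂π|
      ≤ deviationBound κ π k a n x + ∫ y, deviationBound κ π k a n y ∂π := by
  obtain ⟨c, hc⟩ := h.exists_abs_iterate_sub_le hf hf1 n
  obtain ⟨C, hC⟩ := h.exists_abs_deviationBound_le n
  -- Invariance keeps the mean of the iterates fixed, so the unknown constant `c` can be traded for
  -- the mean at the cost of one more `∫ Vₙ dπ`.
  have hint : ∫ y, (fun (g : X → ℝ) (x : X) => ∫ y, g y ∂(κ x))^[n] f y ∂π = ∫ y, f y ∂π := by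
    clear hc hC
    induction n with
    | zero => rfl
    | succ n ih =>
      obtain ⟨hgm, hg1⟩ := measurable_and_abs_iterate_le (κ := κ) hf hf1 n
      rw [← ih]
      simp only [Function.iterate_succ', Function.comp_apply]
      rw [← integral_comp_measure hgm 1 hg1, hinv]
  obtain ⟨hgm, hg1⟩ := measurable_and_abs_iterate_le (κ := κ) hf hf1 n
  rw [← hint]
  set g := (fun (g : X → ℝ) (x : X) => ∫ y, g y ∂(κ x))^[n] f
  have hgi : Integrable g π := integrable_of_measurable_of_abs_le hgm 1 hg1
  have h2 : |∫ y, g y ∂π - c| ≤ ∫ y, deviationBound κ π k a n y ∂π := by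
    have : ∫ y, g y ∂π - c = ∫ y, (g y - c) ∂π := by
      rw [integral_sub hgi (integrable_const _)]; simp
    rw [this]
    refine (abs_integral_le_integral_abs).trans (integral_mono ?_ ?_ hc)
    · exact (hgi.sub (integrable_const _)).abs
    · exact integrable_of_measurable_of_abs_le (h.measurable_deviationBound n) C hC
  calc |g x - ∫ y, g y ∂π| ≤ |g x - c| + |c - ∫ y, g y ∂π| := abs_sub_le _ _ _
    _ ≤ _ := add_le_add (hc x) (by rwa [abs_sub_comm])

end Contraction

/-! ### Existence of a minorant and uniform convergence in mean -/

section Existence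

variable {X : Type*} [MeasurableSpace X] {κ : Kernel X X} [IsMarkovKernel κ] {π : Measure X}
  [IsProbabilityMeasure π]

theorem tendsto_measureReal_setOf_lt_inv {f : X → ℝ≥0∞} (hf : Measurable f)
    (h : ∀ᵐ x ∂π, 0 < f x) :
    Tendsto (fun m : ℕ => π.real {x | f x < ENNReal.ofReal (1 / ((m : ℝ) + 1))}) atTop (𝓝 0) := by
  have hmeas : ∀ m : ℕ, MeasurableSet {x | f x < ENNReal.ofReal (1 / ((m : ℝ) + 1))} :=
    fun m => measurableSet_lt hf measurable_const
  have h1 : Tendsto (fun m : ℕ => π {x | f x < ENNReal.ofReal (1 / ((m : ℝ) + 1))}) atTop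
      (𝓝 (π (⋂ m : ℕ, {x | f x < ENNReal.ofReal (1 / ((m : ℝ) + 1))}))) := by
    refine tendsto_measure_iInter_atTop (fun m => (hmeas m).nullMeasurableSet) ?_
      ⟨0, measure_ne_top _ _⟩
    intro m n hmn x hx
    refine lt_of_lt_of_le hx (ENNReal.ofReal_le_ofReal ?_)
    exact one_div_le_one_div_of_le (by positivity) (by simpa using hmn)
  have h2 : π (⋂ m : ℕ, {x | f x < ENNReal.ofReal (1 / ((m : ℝ) + 1))}) = 0 := by
    refine measure_mono_null (t := {x | ¬ 0 < f x}) (fun x hx hpos => ?_) h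
    have h3 : Tendsto (fun m : ℕ => ENNReal.ofReal (1 / ((m : ℝ) + 1))) atTop (𝓝 0) := by
      simpa using ENNReal.tendsto_ofReal (tendsto_one_div_add_atTop_nhds_zero_nat (𝕜 := ℝ))
    have h4 : f x ≤ 0 := ge_of_tendsto' h3 fun m => (mem_iInter.1 hx m).le
    exact absurd hpos (not_lt.2 h4)
  rw [h2] at h1
  exact ENNReal.toReal_zero ▸ (ENNReal.tendsto_toReal ENNReal.zero_ne_top).comp h1

/-- By Fubini almost every column of `d` is positive almost everywhere, so its sublevel sets shrink
to a null set. This a.e. convergence in `y` implies convergence in measure, so a single threshold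
`η` serves all `y` outside a set of measure below `δ`. -/
theorem exists_measurableSet_measureReal_lt {d : X → X → ℝ≥0∞}
    (hdm : Measurable (fun p : X × X => d p.1 p.2)) (hpos : ∀ᵐ x ∂π, ∀ᵐ y ∂π, 0 < d x y)
    {δ : ℝ} (hδ : 0 < δ) :
    ∃ (S : Set X) (η : ℝ), MeasurableSet S ∧ π.real Sᶜ < δ ∧ 0 < η ∧
      ∀ y ∈ S, π.real {x | d x y < ENNReal.ofReal η} < 1 / 4 := by
  have hS : MeasurableSet {p : X × X | 0 < d p.1 p.2} := measurableSet_lt measurable_const hdm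
  have hpos' : ∀ᵐ y ∂π, ∀ᵐ x ∂π, 0 < d x y :=
    (Measure.ae_ae_comm (p := fun x y => 0 < d x y) hS).1 hpos
  have hbadm : ∀ m : ℕ, Measurable fun y =>
      π.real {x | d x y < ENNReal.ofReal (1 / ((m : ℝ) + 1))} := fun m =>
    (measurable_measure_prodMk_right (measurableSet_lt hdm measurable_const)).ennreal_toReal
  have hbad : ∀ᵐ y ∂π, Tendsto
      (fun m : ℕ => π.real {x | d x y < ENNReal.ofReal (1 / ((m : ℝ) + 1))}) atTop (𝓝 0) := by
    filter_upwards [hpos'] with y hy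
    exact tendsto_measureReal_setOf_lt_inv (hdm.comp measurable_prodMk_right) hy
  have hlim : Tendsto (fun m : ℕ => π.real
      {y | 1 / 4 ≤ ‖π.real {x | d x y < ENNReal.ofReal (1 / ((m : ℝ) + 1))} - 0‖}) atTop (𝓝 0) :=
    tendstoInMeasure_iff_measureReal_norm.1
      (tendstoInMeasure_of_tendsto_ae (fun m => (hbadm m).aestronglyMeasurable) hbad) (1 / 4)
      (by norm_num)
  obtain ⟨m, hm⟩ := (hlim.eventually (gt_mem_nhds hδ)).exists
  refine ⟨{y | π.real {x | d x y < ENNReal.ofReal (1 / ((m : ℝ) + 1))} < 1 / 4},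
    1 / ((m : ℝ) + 1), measurableSet_lt (hbadm m) measurable_const, ?_, by positivity,
    fun y hy => hy⟩
  refine lt_of_le_of_lt (measureReal_mono fun y hy => ?_) hm
  have h1 : 1 / 4 ≤ π.real {x | d x y < ENNReal.ofReal (1 / ((m : ℝ) + 1))} := not_lt.1 hy
  rw [mem_ofPred_eq, sub_zero]
  exact h1.trans (le_abs_self _)

theorem ae_ae_rnDeriv_pos [MeasurableSpace.CountableOrCountablyGenerated X X]
    (hac : ∀ᵐ x ∂π, π ≪ κ x) :
    ∀ᵐ x ∂π, ∀ᵐ y ∂π, 0 < κ.rnDeriv (Kernel.const X π) x y := by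
  filter_upwards [hac] with x hx
  have h1 : κ.rnDeriv (Kernel.const X π) x =ᵐ[π] (κ x).rnDeriv π := by
    have := Kernel.rnDeriv_eq_rnDeriv_measure (κ := κ) (η := Kernel.const X π) (a := x)
    rwa [Kernel.const_apply] at this
  filter_upwards [h1, Measure.rnDeriv_pos' hx] with y hy hy'
  rw [hy]
  exact hy'

-- Truncating the density to the two values `0` and `η` makes it bounded and gives a bound `a` free
-- of `x`. The 1/4 of bad points in each column of `S` leaves the 3/4 that `IsMinorant` requires.
open Classical in
theorem isMinorant_ite {d : X → X → ℝ≥0∞} (hdm : Measurable (fun p : X × X => d p.1 p.2))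
    (hd : ∀ x, π.withDensity (d x) ≤ κ x) {S : Set X} (hS : MeasurableSet S) {η : ℝ} (hη : 0 < η)
    (hcol : ∀ y ∈ S, π.real {x | d x y < ENNReal.ofReal η} < 1 / 4) :
    IsMinorant κ π (fun x y => if y ∈ S ∧ ENNReal.ofReal η ≤ d x y then η else 0)
      (fun y => if y ∈ S then η else 0) η := by
  have hE : MeasurableSet {p : X × X | ENNReal.ofReal η ≤ d p.1 p.2} :=
    measurableSet_le measurable_const hdm
  refine ⟨?_, ?_, fun x y => ?_, fun x y => ?_, fun y => ?_, fun x => ?_, fun y => ?_⟩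
  · exact Measurable.ite ((measurable_snd hS).inter hE) measurable_const measurable_const
  · exact Measurable.ite hS measurable_const measurable_const
  · split_ifs <;> simp [hη.le]
  · by_cases hy : y ∈ S <;> by_cases hy' : ENNReal.ofReal η ≤ d x y <;> simp [hy, hy', hη.le]
  · split_ifs <;> simp [hη.le]
  · refine le_trans (withDensity_mono (ae_of_all _ fun y => ?_)) (hd x)
    dsimp only
    split_ifs with hy
    · exact hy.2
    · simp
  · by_cases hy : y ∈ S
    · have hlt : MeasurableSet {x | d x y < ENNReal.ofReal η} :=
        measurableSet_lt (hdm.comp measurable_prodMk_right) measurable_const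
      have h1 : ∀ x, (if y ∈ S ∧ ENNReal.ofReal η ≤ d x y then η else 0)
          = {x | d x y < ENNReal.ofReal η}ᶜ.indicator (fun _ => η) x := fun x => by
        simp [indicator, hy]
      simp only [h1]
      rw [integral_indicator hlt.compl, setIntegral_const, probReal_compl_eq_one_sub hlt,
        if_pos hy, smul_eq_mul]
      nlinarith [hcol y hy]
    · simp [hy]

theorem exists_isMinorant [MeasurableSpace.CountableOrCountablyGenerated X X]
    (hac : ∀ᵐ x ∂π, π ≪ κ x) {δ : ℝ} (hδ : 0 < δ) :
    ∃ (S : Set X) (k : X → X → ℝ) (a : X → ℝ) (M : ℝ), MeasurableSet S ∧ π.real Sᶜ < δ ∧ 0 < M ∧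
      (∀ y ∈ S, a y = M) ∧ IsMinorant κ π k a M := by
  classical
  obtain ⟨S, η, hS, hSδ, hη, hcol⟩ := exists_measurableSet_measureReal_lt
    (Kernel.measurable_rnDeriv κ (Kernel.const X π)) (ae_ae_rnDeriv_pos hac) hδ
  refine ⟨S, _, _, η, hS, hSδ, hη, fun y hy => if_pos hy,
    isMinorant_ite (Kernel.measurable_rnDeriv κ (Kernel.const X π)) (fun x => ?_) hS hη hcol⟩
  have := Kernel.withDensity_rnDeriv_le κ (Kernel.const X π) x
  rwa [Kernel.withDensity_apply _ (Kernel.measurable_rnDeriv _ _), Kernel.const_apply] at this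

/-- On `S` the weight `a` equals `M` and can be divided out; off `S` only the uniform bound 3 is
available. -/
theorem IsMinorant.integral_deviationBound_le {k : X → X → ℝ} {a : X → ℝ} {M : ℝ} {S : Set X}
    (h : IsMinorant κ π k a M) (hinv : κ ∘ₘ π = π) (hS : MeasurableSet S) (hM : 0 < M)
    (ha : ∀ y ∈ S, a y = M) (n : ℕ) :
    ∫ x, deviationBound κ π k a n x ∂π
      ≤ M⁻¹ * ∫ y, a y * deviationBound κ π k a n y ∂π + 3 * π.real Sᶜ := by
  have h0 := h.deviationBound_nonneg n
  have hm := h.measurable_deviationBound n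
  have hC : ∀ x, |deviationBound κ π k a n x| ≤ 3 := fun x => by
    rw [abs_of_nonneg (h0 x)]; exact h.deviationBound_le_three hinv n x
  have hind : Integrable (Sᶜ.indicator fun _ => (3 : ℝ)) π :=
    (integrable_const _).indicator hS.compl
  have h1 : 3 * π.real Sᶜ = ∫ x, Sᶜ.indicator (fun _ => (3 : ℝ)) x ∂π := by
    rw [integral_indicator hS.compl, setIntegral_const, smul_eq_mul, mul_comm]
  rw [h1, ← integral_const_mul, ← integral_add ((h.integrable_bound_mul hm hC).const_mul _) hind]
  refine integral_mono (integrable_of_measurable_of_abs_le hm 3 hC)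
    (((h.integrable_bound_mul hm hC).const_mul _).add hind) fun y => ?_
  by_cases hy : y ∈ S
  · simp only [indicator, mem_compl_iff, hy, not_true_eq_false, if_false, ha y hy, add_zero]
    rw [inv_mul_cancel_left₀ hM.ne']
  · simp only [indicator, mem_compl_iff, hy, not_false_eq_true, if_true]
    have h2 : 0 ≤ M⁻¹ * (a y * deviationBound κ π k a n y) :=
      mul_nonneg (inv_nonneg.2 hM.le) (mul_nonneg (h.bound_nonneg y) (h0 y))
    have h3 := h.deviationBound_le_three hinv n y
    linarith

/-- If almost every transition probability dominates the invariant law, the iterates of the kernel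
converge in mean to the invariant law, uniformly over functions bounded by one. -/
theorem exists_uniform_bound_iterate [MeasurableSpace.CountableOrCountablyGenerated X X]
    (hac : ∀ᵐ x ∂π, π ≪ κ x) (hinv : κ ∘ₘ π = π) {ε : ℝ} (hε : 0 < ε) :
    ∀ᶠ n in atTop, ∃ W : X → ℝ, Integrable W π ∧ ∫ x, W x ∂π ≤ ε ∧
      ∀ f : X → ℝ, Measurable f → (∀ x, |f x| ≤ 1) → ∀ x,
        |(fun (g : X → ℝ) (x : X) => ∫ y, g y ∂(κ x))^[n] f x - ∫ y, f y ∂π| ≤ W x := by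
  -- With `δ = ε/12` the part off `S` contributes at most `3δ = ε/4`, and the part on `S` less than
  -- `ε/4` eventually. `W` integrates to twice the mean of the deviation bound, hence to at most
  -- `ε`.
  obtain ⟨S, k, a, M, hS, hSδ, hM, ha, h⟩ := exists_isMinorant hac (δ := ε / 12) (by positivity)
  have hlim := (h.tendsto_integral_bound_mul hinv).const_mul M⁻¹
  rw [mul_zero] at hlim
  filter_upwards [hlim.eventually (gt_mem_nhds (show 0 < ε / 4 by positivity))] with n hn
  obtain ⟨C, hC⟩ := h.exists_abs_deviationBound_le n
  have hi : Integrable (deviationBound κ π k a n) π :=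
    integrable_of_measurable_of_abs_le (h.measurable_deviationBound n) C hC
  refine ⟨fun x => deviationBound κ π k a n x + ∫ y, deviationBound κ π k a n y ∂π,
    hi.add (integrable_const _), ?_, fun f hf hf1 x => h.abs_iterate_sub_integral_le hinv hf hf1 n x⟩
  rw [integral_add hi (integrable_const _)]
  have := h.integral_deviationBound_le hinv hS hM ha n
  simp only [integral_const, probReal_univ, one_smul]
  linarith

end Existence

/-! ### Markov property for the whole future, restricted to past events -/

section MarkovProperty

set_option linter.unusedSectionVars false

variable {Ω : Type*} [MeasurableSpace Ω] {P : Measure Ω} {U : ℤ → Ω → ℝ}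

theorem sigmaPast_mono (U : ℤ → Ω → ℝ) {m n : ℤ} (h : m ≤ n) : sigmaPast U m ≤ sigmaPast U n :=
  iSup₂_le fun k hk => le_iSup₂_of_le k (hk.trans h) le_rfl

theorem IsStationaryMarkovChain.sigmaPast_le (hU : IsStationaryMarkovChain P U) (n : ℤ) :
    sigmaPast U n ≤ ‹MeasurableSpace Ω› :=
  iSup₂_le fun k _ => (hU.measurable k).comap_le

theorem measurableSet_sigmaPast_preimage (U : ℤ → Ω → ℝ) (n : ℤ) {S : Set ℝ}
    (hS : MeasurableSet S) : MeasurableSet[sigmaPast U n] (U n ⁻¹' S) :=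
  (le_iSup₂_of_le (f := fun k (_ : k ≤ n) => MeasurableSpace.comap (U k) inferInstance) n le_rfl
    le_rfl) _ ⟨S, hS, rfl⟩

variable [IsProbabilityMeasure P]

theorem IsStationaryMarkovChain.comp_map_zero (hU : IsStationaryMarkovChain P U) :
    condDistrib (U 1) (U 0) P ∘ₘ P.map (U 0) = P.map (U 0) := by
  rw [condDistrib_comp_map (hU.measurable 0).aemeasurable (hU.measurable 1).aemeasurable,
    hU.map_eq 1]

theorem IsStationaryMarkovChain.condDistrib_succ_ae_eq (hU : IsStationaryMarkovChain P U) (n : ℤ) :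
    condDistrib (U (n + 1)) (U n) P =ᵐ[P.map (U n)] condDistrib (U 1) (U 0) P := by
  refine condDistrib_ae_eq_of_measure_eq_compProd _ (hU.measurable _).aemeasurable ?_
  rw [hU.map_pair_eq, hU.map_eq n, compProd_map_condDistrib (hU.measurable 1).aemeasurable]

/-- This recasts the conditional-expectation form of the Markov property in terms of measures:
restriction to a past event only changes the law that `κ` acts on. Stationarity lets the same `κ`
serve at every time. -/
theorem IsStationaryMarkovChain.map_succ_restrict (hU : IsStationaryMarkovChain P U) (n : ℤ)
    {A : Set Ω} (hA : MeasurableSet[sigmaPast U n] A) :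
    (P.restrict A).map (U (n + 1))
      = condDistrib (U 1) (U 0) P ∘ₘ (P.restrict A).map (U n) := by
  ext S hS
  set κ := condDistrib (U 1) (U 0) P
  have hAm : MeasurableSet A := hU.sigmaPast_le n _ hA
  have hpre : MeasurableSet (U (n + 1) ⁻¹' S) := hU.measurable _ hS
  have hκm : Measurable fun x => κ x S := Kernel.measurable_coe κ hS
  rw [Measure.map_apply (hU.measurable _) hS, Measure.bind_apply hS κ.aemeasurable,
    lintegral_map hκm (hU.measurable n), Measure.restrict_apply hpre]
  have h1 : P⟦U (n + 1) ⁻¹' S | sigmaPast U n⟧ =ᵐ[P] fun ω => (κ (U n ω)).real S := by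
    refine (hU.markov n S hS).trans ((condDistrib_ae_eq_condExp (hU.measurable n)
      (hU.measurable (n + 1)) hS).symm.trans ?_)
    filter_upwards [ae_of_ae_map (hU.measurable n).aemeasurable (hU.condDistrib_succ_ae_eq n)]
      with ω hω
    rw [hω]
  have h2 : P.real (U (n + 1) ⁻¹' S ∩ A) = ∫ ω in A, (κ (U n ω)).real S ∂P := by
    rw [← integral_congr_ae (ae_restrict_of_ae h1), setIntegral_condExp (hU.sigmaPast_le n) _ hA,
      integral_indicator hpre, setIntegral_const, smul_eq_mul, mul_one, measureReal_def,
      measureReal_def, Measure.restrict_apply hpre]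
    exact (integrable_const _).indicator hpre
  have h3 : ∫ ω in A, (κ (U n ω)).real S ∂P = (∫⁻ ω in A, κ (U n ω) S ∂P).toReal :=
    integral_toReal (hκm.comp (hU.measurable n)).aemeasurable
      (ae_of_all _ fun _ => measure_lt_top _ _)
  rw [h3, measureReal_def] at h2
  refine (ENNReal.toReal_eq_toReal_iff' (measure_ne_top _ _) ?_).1 h2
  refine ne_top_of_le_ne_top (b := ∫⁻ _ in A, 1 ∂P) (by simp) (lintegral_mono fun ω => prob_le_one)

theorem IsStationaryMarkovChain.integral_map_restrict (hU : IsStationaryMarkovChain P U)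
    {A : Set Ω} (hA : MeasurableSet[sigmaPast U 0] A) (n : ℕ) {f : ℝ → ℝ} (hf : Measurable f)
    (hf1 : ∀ x, |f x| ≤ 1) :
    ∫ x, f x ∂((P.restrict A).map (U n))
      = ∫ x, (fun (g : ℝ → ℝ) (x : ℝ) => ∫ y, g y ∂(condDistrib (U 1) (U 0) P x))^[n] f x
        ∂((P.restrict A).map (U 0)) := by
  induction n generalizing f with
  | zero => rfl
  | succ n ih =>
    have : IsFiniteMeasure ((P.restrict A).map (U n)) := inferInstance
    rw [Function.iterate_succ_apply, Nat.cast_succ,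
      hU.map_succ_restrict n (sigmaPast_mono U (Int.natCast_nonneg n) _ hA),
      integral_comp_measure hf 1 hf1]
    exact ih (measurable_integral_kernel hf) fun x => abs_integral_le_of_abs_le hf1

/-- Backward recursion: `G` is the indicator of `S 0` times the `κ`-average of the function for the
shifted cylinder. Having `G` chosen before `n` and `A` allows it to be identified through one family
of events and then used for all past events. -/
theorem IsStationaryMarkovChain.exists_lintegral_cylinder (hU : IsStationaryMarkovChain P U)
    (m : ℕ) (S : ℕ → Set ℝ) (hS : ∀ k, MeasurableSet (S k)) :
    ∃ G : ℝ → ℝ≥0∞, Measurable G ∧ ∀ (n : ℤ) (A : Set Ω), MeasurableSet[sigmaPast U n] A →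
      P (A ∩ {ω | ∀ k : ℕ, k < m → U (n + k) ω ∈ S k})
        = ∫⁻ x, G x ∂((P.restrict A).map (U n)) := by
  induction m generalizing S with
  | zero =>
    refine ⟨fun _ => 1, measurable_const, fun n A _ => ?_⟩
    simp [Measure.map_apply (hU.measurable n) MeasurableSet.univ]
  | succ m ih =>
    obtain ⟨G, hG, hGA⟩ := ih (fun k => S (k + 1)) fun k => hS _
    refine ⟨(S 0).indicator fun x => ∫⁻ y, G y ∂(condDistrib (U 1) (U 0) P x),
      hG.lintegral_kernel.indicator (hS 0), fun n A hA => ?_⟩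
    have hA' : MeasurableSet[sigmaPast U n] (A ∩ U n ⁻¹' S 0) :=
      MeasurableSet.inter hA (measurableSet_sigmaPast_preimage U n (hS 0))
    have hset : A ∩ {ω | ∀ k : ℕ, k < m + 1 → U (n + k) ω ∈ S k}
        = (A ∩ U n ⁻¹' S 0) ∩ {ω | ∀ k : ℕ, k < m → U (n + 1 + k) ω ∈ S (k + 1)} := by
      ext ω
      simp only [mem_inter_iff, mem_ofPred_eq, mem_preimage, and_assoc, and_congr_right_iff]
      intro _
      constructor
      · intro h
        refine ⟨by simpa using h 0 (by omega), fun k hk => ?_⟩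
        have := h (k + 1) (by omega)
        rwa [Nat.cast_succ, add_comm (k : ℤ) 1, ← add_assoc] at this
      · rintro ⟨h0, h⟩ k hk
        cases k with
        | zero => simpa using h0
        | succ k =>
          rw [Nat.cast_succ, add_comm (k : ℤ) 1, ← add_assoc]
          exact h k (by omega)
    have hres : (P.restrict (A ∩ U n ⁻¹' S 0)).map (U n)
        = ((P.restrict A).map (U n)).restrict (S 0) := by
      rw [Measure.restrict_map (hU.measurable n) (hS 0),
        Measure.restrict_restrict (hU.measurable n (hS 0)), inter_comm]
    rw [hset, hGA (n + 1) _ (sigmaPast_mono U (by omega) _ hA'), hU.map_succ_restrict n hA',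
      Measure.lintegral_bind (Kernel.aemeasurable _) hG.aemeasurable, hres,
      lintegral_indicator (hS 0)]

/-- The path of the chain from time `n` on. -/
def pathFrom (U : ℤ → Ω → ℝ) (n : ℤ) (ω : Ω) (k : ℕ) : ℝ := U (n + k) ω

theorem IsStationaryMarkovChain.measurable_pathFrom (hU : IsStationaryMarkovChain P U) (n : ℤ) :
    Measurable (pathFrom U n) :=
  measurable_pi_lambda _ fun _ => hU.measurable _

theorem sigmaFuture_le_comap_pathFrom (U : ℤ → Ω → ℝ) (n : ℤ) :
    sigmaFuture U n ≤ MeasurableSpace.comap (pathFrom U n) inferInstance := by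
  refine iSup₂_le fun k hk => ?_
  rintro _ ⟨S, hS, rfl⟩
  refine ⟨(fun z : ℕ → ℝ => z (k - n).toNat) ⁻¹' S, measurable_pi_apply _ hS, ?_⟩
  ext ω
  simp [pathFrom, Int.toNat_of_nonneg (sub_nonneg.2 hk)]

/-- The Markov property for the whole future. -/
theorem IsStationaryMarkovChain.map_pathFrom_restrict (hU : IsStationaryMarkovChain P U) (n : ℤ)
    {A : Set Ω} (hA : MeasurableSet[sigmaPast U n] A) :
    (P.restrict A).map (pathFrom U n)
      = condDistrib (pathFrom U n) (U n) P ∘ₘ (P.restrict A).map (U n) := by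
  classical
  have hZ := hU.measurable_pathFrom n
  have hUn := hU.measurable n
  refine ext_of_generate_finite _ generateFrom_squareCylinders.symm
    (isPiSystem_squareCylinders (fun _ => MeasurableSpace.isPiSystem_measurableSet) (by simp)) ?_ ?_
  · rintro _ ⟨s, t, ht, rfl⟩
    have ht' : ∀ k, MeasurableSet (t k) := fun k => ht k (mem_univ k)
    have hcyl : MeasurableSet ((s : Set ℕ).pi t) :=
      MeasurableSet.pi (Finset.countable_toSet _) fun i _ => ht' i
    -- A window of length `s.sup id + 1` contains every index of `s`; the remaining coordinates are
    -- left free.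
    obtain ⟨G, hG, hGA⟩ := hU.exists_lintegral_cylinder (s.sup id + 1)
      (fun k => if k ∈ s then t k else univ)
      (fun k => by split_ifs; exacts [ht' k, MeasurableSet.univ])
    have hpre : {ω | ∀ k : ℕ, k < s.sup id + 1 → U (n + k) ω ∈ if k ∈ s then t k else univ}
        = pathFrom U n ⁻¹' ((s : Set ℕ).pi t) := by
      ext ω
      simp only [mem_ofPred_eq, mem_preimage, Set.mem_pi, SetLike.mem_coe]
      constructor
      · intro h k hk
        have hmem := h k (Nat.lt_succ_of_le (Finset.le_sup (f := id) hk))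
        rwa [if_pos hk] at hmem
      · intro h k _
        split_ifs with hk
        exacts [h k hk, mem_univ _]
    have hGA' : ∀ A, MeasurableSet[sigmaPast U n] A →
        P (A ∩ pathFrom U n ⁻¹' ((s : Set ℕ).pi t)) = ∫⁻ x, G x ∂((P.restrict A).map (U n)) :=
      fun A hA => hpre ▸ hGA n A hA
    have hτm : Measurable fun x => condDistrib (pathFrom U n) (U n) P x ((s : Set ℕ).pi t) :=
      Kernel.measurable_coe _ hcyl
    -- Events `U n ⁻¹' T` already determine `G` almost everywhere as the conditional probability of
    -- the cylinder given `U n`.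
    have hae : (fun x => condDistrib (pathFrom U n) (U n) P x ((s : Set ℕ).pi t))
        =ᵐ[P.map (U n)] G := by
      refine ae_eq_of_forall_setLIntegral_eq_of_sigmaFinite hτm hG fun T hT _ => ?_
      rw [setLIntegral_map hT hτm hUn,
        setLIntegral_preimage_condDistrib hUn hZ.aemeasurable hcyl hT,
        hGA' _ (measurableSet_sigmaPast_preimage U n hT), Measure.restrict_map hUn hT]
    rw [Measure.map_apply hZ hcyl, Measure.restrict_apply (hZ hcyl), inter_comm, hGA' A hA,
      Measure.bind_apply hcyl (Kernel.aemeasurable _)]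
    refine (lintegral_congr_ae ?_).symm
    exact (Measure.absolutelyContinuous_of_le Measure.restrict_le_self).map hUn hae
  · rw [Measure.map_apply hZ MeasurableSet.univ, Measure.bind_apply MeasurableSet.univ
      (Kernel.aemeasurable _)]
    simp [Measure.map_apply hUn MeasurableSet.univ]

/-- Conditioning at time `n` replaces the future event by a function of `U n` bounded by one, and
`n` steps of `κ` carry this function back to time `0`. -/
theorem IsStationaryMarkovChain.measureReal_inter_preimage (hU : IsStationaryMarkovChain P U)
    (n : ℕ) {A : Set Ω} (hA : MeasurableSet[sigmaPast U 0] A) {D : Set (ℕ → ℝ)}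
    (hD : MeasurableSet D) :
    P.real (A ∩ pathFrom U n ⁻¹' D) = ∫ x,
      (fun (g : ℝ → ℝ) (x : ℝ) => ∫ y, g y ∂(condDistrib (U 1) (U 0) P x))^[n]
        (fun x => (condDistrib (pathFrom U n) (U n) P x).real D) x ∂((P.restrict A).map (U 0)) := by
  have hτm : Measurable fun x => condDistrib (pathFrom U n) (U n) P x D :=
    Kernel.measurable_coe _ hD
  have hZ := hU.measurable_pathFrom n
  rw [← hU.integral_map_restrict (f := fun x => (condDistrib (pathFrom U n) (U n) P x).real D)
    hA n hτm.ennreal_toReal fun x => by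
      rw [abs_of_nonneg measureReal_nonneg]; exact measureReal_le_one]
  have h1 := congrArg (fun m => m D)
    (hU.map_pathFrom_restrict n (sigmaPast_mono U (Int.natCast_nonneg n) _ hA))
  simp only [Measure.map_apply hZ hD, Measure.restrict_apply (hZ hD),
    Measure.bind_apply hD (Kernel.aemeasurable _)] at h1
  rw [inter_comm, measureReal_def, h1]
  exact (integral_toReal hτm.aemeasurable (ae_of_all _ fun _ => measure_lt_top _ _)).symm

end MarkovProperty

/-! ### From uniform convergence in mean to the mixing coefficient -/

section AbsoluteRegularity

set_option linter.unusedSectionVars false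

theorem iterate_integral_sum {X : Type*} [MeasurableSpace X] {κ : Kernel X X} [IsMarkovKernel κ]
    {ι : Type*} (s : Finset ι) (c : ι → ℝ) (g : ι → X → ℝ) (hg : ∀ j, Measurable (g j))
    (hg1 : ∀ j x, |g j x| ≤ 1) (n : ℕ) (x : X) :
    (fun (g : X → ℝ) (x : X) => ∫ y, g y ∂(κ x))^[n] (fun x => ∑ j ∈ s, c j * g j x) x
      = ∑ j ∈ s, c j * (fun (g : X → ℝ) (x : X) => ∫ y, g y ∂(κ x))^[n] (g j) x := by
  induction n generalizing x with
  | zero => rfl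
  | succ n ih =>
    simp only [Function.iterate_succ', Function.comp_apply]
    rw [integral_congr_ae (ae_of_all _ ih), integral_finsetSum]
    · simp only [integral_const_mul]
    · intro j _
      obtain ⟨hm, h1⟩ := measurable_and_abs_iterate_le (κ := κ) (hg j) (hg1 j) n
      exact (integrable_of_measurable_of_abs_le hm 1 h1).const_mul _

/-- Since `p` need not be surjective, sets with disjoint preimages may overlap outside its range.
Removing the overlaps leaves the preimages unchanged, and disjointness is what makes the conditional
probabilities sum to at most one. -/
theorem exists_disjoint_preimages {Ω Z ι : Type*} [MeasurableSpace Z] [Countable ι]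
    {p : Ω → Z} {B : ι → Set Ω} (hB : ∀ j, MeasurableSet[MeasurableSpace.comap p inferInstance] (B j))
    (hd : Pairwise fun i j => Disjoint (B i) (B j)) :
    ∃ D : ι → Set Z, (∀ j, MeasurableSet (D j)) ∧ (Pairwise fun i j => Disjoint (D i) (D j)) ∧
      ∀ j, p ⁻¹' D j = B j := by
  choose E hE hEB using hB
  refine ⟨fun j => E j \ ⋃ i ∈ {i | i ≠ j}, E i, fun j => (hE j).diff ?_, fun i j hij => ?_,
    fun j => ?_⟩
  · exact MeasurableSet.biUnion (to_countable _) fun i _ => hE i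
  · refine Set.disjoint_left.2 ?_
    rintro z ⟨hz, -⟩ ⟨-, hz'⟩
    exact hz' (mem_biUnion (show i ∈ {i | i ≠ j} from hij) hz)
  · rw [preimage_sdiff, hEB j, preimage_iUnion₂]
    refine (sdiff_eq_left.2 ?_)
    rw [disjoint_iUnion₂_right]
    intro i hi
    rw [hEB i]
    exact hd (Ne.symm hi)

theorem sum_measureReal_le_one {Z ι : Type*} [MeasurableSpace Z] [Fintype ι] {m : Measure Z}
    [IsProbabilityMeasure m] {D : ι → Set Z} (hD : ∀ j, MeasurableSet (D j))
    (hd : Pairwise fun i j => Disjoint (D i) (D j)) : ∑ j, m.real (D j) ≤ 1 := by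
  rw [← measureReal_iUnion_fintype hd hD]
  exact measureReal_le_one

/-- A bound valid for signed combinations is a bound for the sum of absolute values. -/
theorem sum_abs_le_of_forall_sign {ι : Type*} (s : Finset ι) (u : ι → ℝ) (W : ℝ)
    (h : ∀ c : ι → ℝ, (∀ j, |c j| ≤ 1) → |∑ j ∈ s, c j * u j| ≤ W) : ∑ j ∈ s, |u j| ≤ W := by
  have h1 := h (fun j => if 0 ≤ u j then 1 else -1) fun j => by split_ifs <;> simp
  refine le_trans (le_of_eq (Finset.sum_congr rfl fun j _ => ?_)) ((le_abs_self _).trans h1)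
  split_ifs with hj
  · rw [abs_of_nonneg hj, one_mul]
  · rw [abs_of_neg (not_le.1 hj), neg_one_mul]

variable {Ω : Type*} [MeasurableSpace Ω] {P : Measure Ω} [IsProbabilityMeasure P] {U : ℤ → Ω → ℝ}

/-- For fixed `x`, the sum over the future partition is the deviation of one iterate, that of a
signed combination of conditional probabilities, which is bounded by one. Hence `W` bounds the whole
sum, whatever the number of cells. Summing over the past partition reassembles `π`. -/
theorem IsStationaryMarkovChain.sum_abs_sub_le (hU : IsStationaryMarkovChain P U) {n : ℕ}
    {W : ℝ → ℝ} (hW : Integrable W (P.map (U 0)))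
    (hbound : ∀ f : ℝ → ℝ, Measurable f → (∀ x, |f x| ≤ 1) → ∀ x,
      |(fun (g : ℝ → ℝ) (x : ℝ) => ∫ y, g y ∂(condDistrib (U 1) (U 0) P x))^[n] f x
        - ∫ y, f y ∂(P.map (U 0))| ≤ W x)
    {N M : ℕ} {A : Fin N → Set Ω} {B : Fin M → Set Ω}
    (hA : IsFinitePartition (sigmaPast U 0) A) (hB : IsFinitePartition (sigmaFuture U n) B) :
    ∑ i, ∑ j, |P.real (A i ∩ B j) - P.real (A i) * P.real (B j)| ≤ ∫ x, W x ∂(P.map (U 0)) := by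
  have hU0 := hU.measurable 0
  have := Measure.isProbabilityMeasure_map (μ := P) hU0.aemeasurable
  set π := P.map (U 0) with hπ
  set κ := condDistrib (U 1) (U 0) P
  set τ := condDistrib (pathFrom U n) (U n) P
  obtain ⟨D, hDm, hDd, hDB⟩ := exists_disjoint_preimages
    (fun j => sigmaFuture_le_comap_pathFrom U n _ (hB.measurableSet j)) hB.disjoint
  have hAm : ∀ i, MeasurableSet (A i) := fun i => hU.sigmaPast_le 0 _ (hA.measurableSet i)
  set g : Fin M → ℝ → ℝ := fun j x => (τ x).real (D j)
  have hgm : ∀ j, Measurable (g j) := fun j => (Kernel.measurable_coe τ (hDm j)).ennreal_toReal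
  have hg0 : ∀ j x, 0 ≤ g j x := fun j x => measureReal_nonneg
  have hg1 : ∀ j x, |g j x| ≤ 1 := fun j x => by
    rw [abs_of_nonneg (hg0 j x)]; exact measureReal_le_one
  set T : Fin M → ℝ → ℝ := fun j => (fun (g : ℝ → ℝ) (x : ℝ) => ∫ y, g y ∂(κ x))^[n] (g j) with hT
  have hTm : ∀ j, Measurable (T j) := fun j =>
    (measurable_and_abs_iterate_le (hgm j) (hg1 j) n).1
  have hT1 : ∀ j x, |T j x| ≤ 1 := fun j => (measurable_and_abs_iterate_le (hgm j) (hg1 j) n).2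
  have hpt : ∀ x, ∑ j, |T j x - ∫ y, g j y ∂π| ≤ W x := fun x => by
    refine sum_abs_le_of_forall_sign _ _ _ fun c hc => ?_
    have hfm : Measurable fun x => ∑ j, c j * g j x :=
      Finset.measurable_fun_sum _ fun j _ => (hgm j).const_mul _
    have hf1 : ∀ x, |∑ j, c j * g j x| ≤ 1 := fun x =>
      calc |∑ j, c j * g j x| ≤ ∑ j, |c j * g j x| := Finset.abs_sum_le_sum_abs _ _
        _ ≤ ∑ j, g j x := Finset.sum_le_sum fun j _ => by
          rw [abs_mul, abs_of_nonneg (hg0 j x)]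
          exact mul_le_of_le_one_left (hg0 j x) (hc j)
        _ ≤ 1 := sum_measureReal_le_one hDm hDd
    have h1 := hbound _ hfm hf1 x
    rw [iterate_integral_sum _ c g hgm hg1, integral_finsetSum _ fun j _ =>
      (integrable_of_measurable_of_abs_le (hgm j) 1 (hg1 j)).const_mul _] at h1
    simpa only [integral_const_mul, ← Finset.sum_sub_distrib, ← mul_sub] using h1
  -- The case `A = univ`, where stationarity makes the law of `U n` equal to `π`.
  have hBj : ∀ j, P.real (B j) = ∫ y, g j y ∂π := fun j => by
    have h1 := hU.measureReal_inter_preimage n (A := univ) MeasurableSet.univ (hDm j)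
    rw [← hU.integral_map_restrict (f := g j) MeasurableSet.univ n (hgm j) (hg1 j),
      Measure.restrict_univ, hU.map_eq n, univ_inter, hDB j] at h1
    exact h1
  have hint : ∀ i j, Integrable (fun x => T j x - ∫ y, g j y ∂π) ((P.restrict (A i)).map (U 0)) :=
    fun i j => (integrable_of_measurable_of_abs_le (hTm j) 1 (hT1 j)).sub (integrable_const _)
  have hle : ∀ i, (P.restrict (A i)).map (U 0) ≤ π := fun i =>
    Measure.map_mono Measure.restrict_le_self hU0
  have hterm : ∀ i j, |P.real (A i ∩ B j) - P.real (A i) * P.real (B j)|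
      ≤ ∫ x, |T j x - ∫ y, g j y ∂π| ∂((P.restrict (A i)).map (U 0)) := fun i j => by
    have h1 := hU.measureReal_inter_preimage n (hA.measurableSet i) (hDm j)
    rw [hDB j] at h1
    have h2 : ∫ x, (T j x - ∫ y, g j y ∂π) ∂((P.restrict (A i)).map (U 0))
        = P.real (A i ∩ B j) - P.real (A i) * P.real (B j) := by
      rw [integral_sub (integrable_of_measurable_of_abs_le (hTm j) 1 (hT1 j))
        (integrable_const _), ← h1, hBj j, integral_const, smul_eq_mul,
        map_measureReal_apply hU0 MeasurableSet.univ]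
      simp
    rw [← h2]
    exact abs_integral_le_integral_abs
  calc ∑ i, ∑ j, |P.real (A i ∩ B j) - P.real (A i) * P.real (B j)|
      ≤ ∑ i, ∫ x, W x ∂((P.restrict (A i)).map (U 0)) := by
        refine Finset.sum_le_sum fun i _ => (Finset.sum_le_sum fun j _ => hterm i j).trans ?_
        rw [← integral_finsetSum _ fun j _ => (hint i j).abs]
        exact integral_mono (integrable_finsetSum _ fun j _ => (hint i j).abs)
          (hW.mono_measure (hle i)) hpt
    _ = ∑ i, ∫ ω in A i, W (U 0 ω) ∂P := by
        refine Finset.sum_congr rfl fun i _ => ?_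
        exact integral_map hU0.aemeasurable (hW.mono_measure (hle i)).aestronglyMeasurable
    _ = ∫ x, W x ∂π := by
        have hWU : Integrable (fun ω => W (U 0 ω)) P := hW.comp_measurable hU0
        rw [← integral_iUnion_fintype hAm hA.disjoint fun i => hWU.integrableOn, hA.union,
          setIntegral_univ, hπ, integral_map hU0.aemeasurable hW.aestronglyMeasurable]

theorem betaMixing_le {n : ℕ} {ε : ℝ}
    (h : ∀ (N M : ℕ) (A : Fin N → Set Ω) (B : Fin M → Set Ω),
      IsFinitePartition (sigmaPast U 0) A → IsFinitePartition (sigmaFuture U n) B →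
        ∑ i, ∑ j, |P.real (A i ∩ B j) - P.real (A i) * P.real (B j)| ≤ ε) :
    betaMixing P U n ≤ ENNReal.ofReal ε := by
  -- The factor 1/2 is simply discarded.
  refine (mul_le_of_le_one_left zero_le ?_).trans ?_
  · exact ENNReal.inv_le_one.2 one_le_two
  refine iSup_le fun N => iSup_le fun M => iSup_le fun A => iSup_le fun B => iSup_le fun hA =>
    iSup_le fun hB => ?_
  refine le_trans (le_of_eq ?_) (ENNReal.ofReal_le_ofReal (h N M A B hA hB))
  rw [ENNReal.ofReal_sum_of_nonneg fun i _ => Finset.sum_nonneg fun j _ => abs_nonneg _]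
  exact Finset.sum_congr rfl fun i _ => (ENNReal.ofReal_sum_of_nonneg fun j _ => abs_nonneg _).symm

theorem IsStationaryMarkovChain.isAbsolutelyRegular (hU : IsStationaryMarkovChain P U)
    (h : ∀ᵐ x ∂(P.map (U 0)), P.map (U 0) ≪ condDistrib (U 1) (U 0) P x) :
    IsAbsolutelyRegular P U := by
  have := Measure.isProbabilityMeasure_map (μ := P) (hU.measurable 0).aemeasurable
  refine ENNReal.tendsto_nhds_zero.2 fun ε hε => ?_
  obtain ⟨δ, hδ, hδε⟩ : ∃ δ : ℝ, 0 < δ ∧ ENNReal.ofReal δ ≤ ε := by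
    obtain ⟨r, hr0, hr⟩ := ENNReal.lt_iff_exists_nnreal_btwn.1 hε
    exact ⟨r, by exact_mod_cast hr0, by simpa using hr.le⟩
  filter_upwards [exists_uniform_bound_iterate h hU.comp_map_zero hδ] with n hn
  obtain ⟨W, hW, hWδ, hbound⟩ := hn
  exact (betaMixing_le fun N M A B hA hB =>
    (hU.sum_abs_sub_le hW hbound hA hB).trans hWδ).trans hδε

end AbsoluteRegularity

/-- If the absolutely continuous part of a copula has a strictly positive density on a set of
Lebesgue measure `1`, then the stationary Markov chain it generates is irreducible, aperiodic and
absolutely regular. -/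
theorem proposition3p1 {Ω : Type*} [MeasurableSpace Ω] (P : Measure Ω) [IsProbabilityMeasure P]
    (C : ℝ → ℝ → ℝ) (hC : IsCopula C) (hpos : HasPositiveACDensity C)
    (U : ℤ → Ω → ℝ) (hU : IsGeneratedByCopula P U C) :
    IsIrreducibleChain P U ∧ IsAperiodicChain P U ∧ IsAbsolutelyRegular P U := by
  have h := hU.ae_absolutelyContinuous hpos
  exact ⟨isIrreducibleChain_of_ae_absolutelyContinuous (hU.measurable 0) h,
    isAperiodicChain_of_ae_absolutelyContinuous (hU.measurable 0) h,
    hU.toIsStationaryMarkovChain.isAbsolutelyRegular h⟩
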